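/- For sets in $\mathbb{R}^{n\times n}$ let $\langle\cdot,\cdot\rangle$ be the Frobenius inner product and, for $\varepsilon\ge 0$, let $S^{\varepsilon}=\{x : \exists x_0\in S,\ \sum_{i,j}|x_{ij}-(x_0)_{ij}|\le\varepsilon\}$. The extension complexity $\mathrm{xc}(K)$ of a polyhedron $K\subseteq\mathbb{R}^{n\times n}$ is the least $r$ such that $K=\{x : \exists y\in\mathbb{R}^r,\ y\ge 0,\ Ex+Fy=g\}$ for some finite linear system $Ex+Fy=g$. A spectrahedron is a set of the form $S=\{x : \exists Y\in\mathbb{S}^r_+,\ \langle E_i,x\rangle+\langle F_i,Y\rangle=g_i\ (i=1,\dots,k)\}$ with $E_i\in\mathbb{R}^{n\times n}$, $F_i$ symmetric $r\times r$ and $g_i\in\mathbb{R}$, where $\mathbb{S}^r_+$ is the cone of symmetric positive semidefinite $r\times r$ matrices; its semidefinite extension complexity $\mathrm{xc}_{SDP}(S)$ is the least possible $r$. Let $\mathrm{COR}(n)=\mathrm{conv}\{bb^{\top} : b\in\{0,1\}^n\}$ and $Q(n)=\{x\in\mathbb{R}^{n\times n} : \langle 2\,\mathrm{diag}(a)-aa^{\top},x\rangle\le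 1 \text{ for all } a\in\{0,1\}^n\}$. **Theorem (Polyhedral inapproximability of SDPs).** For every positive integer $n$ there is a spectrahedron $S_n\subseteq\mathbb{R}^{n\times n}$ with $\mathrm{xc}_{SDP}(S_n)\le n+1$ and $\mathrm{COR}(n)\subseteq S_n\subseteq Q(n)\cap[-1,1]^{n\times n}$ such that the following hold. 1. For every constant $\rho\ge 1$ there are $c>0$ and $N$ such that for all $n\ge N$ every polyhedron $K$ with $S_n\subseteq K\subseteq S_n^{\rho-1}$ satisfies $\mathrm{xc}(K)\ge 2^{cn}$; that is, $\mathrm{xc}(K)=2^{\Omega(n)}$. 2. For every $\beta<1/2$ and every $C$ there are $c>0$ and $N$ such that for all $n\ge N$ and all $\rho$ with $1\le\rho\le Cn^{\beta}$, every polyhedron $K$ with $S_n\subseteq K\subseteq S_n^{\rho-1}$ satisfies $\mathrm{xc}(K)\ge 2^{cn^{1-2\beta}}$; that is, $\mathrm{xc}(K)=2^{\Omega(n^{1-2\beta})}$ whenever $\rho=O(n^{\beta})$. -/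

import Mathlib

open scoped Matrix

namespace SDPInapprox

/-- The Frobenius inner product of two real matrices. -/
def frob {m : ℕ} (A B : Matrix (Fin m) (Fin m) ℝ) : ℝ :=
  ∑ i, ∑ j, A i j * B i j

/-- The entrywise `ℓ₁`-norm of a real matrix. -/
def l1Norm {m : ℕ} (A : Matrix (Fin m) (Fin m) ℝ) : ℝ :=
  ∑ i, ∑ j, |A i j|

/-- The closed `ε`-neighbourhood of `S` in the `ℓ₁`-norm. -/
def l1Neighbourhood {n : ℕ} (S : Set (Matrix (Fin n) (Fin n) ℝ)) (ε : ℝ) :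
    Set (Matrix (Fin n) (Fin n) ℝ) :=
  {x | ∃ x₀ ∈ S, l1Norm (x - x₀) ≤ ε}

/-- A polyhedron in `ℝ^{n×n}`: the solution set of a finite system of linear inequalities. -/
def IsPolyhedron {n : ℕ} (K : Set (Matrix (Fin n) (Fin n) ℝ)) : Prop :=
  ∃ (m : ℕ) (A : Fin m → Matrix (Fin n) (Fin n) ℝ) (b : Fin m → ℝ),
    K = {x | ∀ i, frob (A i) x ≤ b i}

/-- `K` has a (linear) extended formulation of size `r`: a system `E x + F y = g`, `y ≥ 0` with
`y ∈ ℝ^r` and finitely many equations, whose projection to `x`-space is `K`. -/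
def HasEF {n : ℕ} (K : Set (Matrix (Fin n) (Fin n) ℝ)) (r : ℕ) : Prop :=
  ∃ (k : ℕ) (E : Fin k → Matrix (Fin n) (Fin n) ℝ) (F : Fin k → Fin r → ℝ) (g : Fin k → ℝ),
    K = {x | ∃ y : Fin r → ℝ, (∀ j, 0 ≤ y j) ∧ ∀ i, frob (E i) x + F i ⬝ᵥ y = g i}

/-- The (linear) extension complexity `xc(K)` of a polyhedron `K`: the minimum size of an extended
formulation of `K` (every polyhedron has one, by slack variables). -/
noncomputable def xc {n : ℕ} (K : Set (Matrix (Fin n) (Fin n) ℝ)) : ℕ :=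
  sInf {r | HasEF K r}

/-- `S` has a semidefinite extended formulation of size `r`: a system
`⟨E_i, x⟩ + ⟨F_i, Y⟩ = g_i` (`i ∈ [k]`), `Y ∈ 𝕊^r_+`, with all `F_i` symmetric, whose projection to
`x`-space is `S`. -/
def HasSemidefiniteEF {n : ℕ} (S : Set (Matrix (Fin n) (Fin n) ℝ)) (r : ℕ) : Prop :=
  ∃ (k : ℕ) (E : Fin k → Matrix (Fin n) (Fin n) ℝ) (F : Fin k → Matrix (Fin r) (Fin r) ℝ)
    (g : Fin k → ℝ), (∀ i, (F i).IsSymm) ∧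
    S = {x | ∃ Y : Matrix (Fin r) (Fin r) ℝ, Y.PosSemidef ∧
      ∀ i, frob (E i) x + frob (F i) Y = g i}

/-- A spectrahedron, in the sense of a set that admits a semidefinite extended formulation
(such a set is automatically convex). -/
def IsSpectrahedron {n : ℕ} (S : Set (Matrix (Fin n) (Fin n) ℝ)) : Prop :=
  ∃ r, HasSemidefiniteEF S r

/-- The semidefinite extension complexity of a spectrahedron `S`: the minimum size of a
semidefinite extended formulation of `S`. -/
noncomputable def xcSDP {n : ℕ} (S : Set (Matrix (Fin n) (Fin n) ℝ)) : ℕ :=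
  sInf {r | HasSemidefiniteEF S r}

/-- `b ∈ {0,1}^n`. -/
def IsBinary {n : ℕ} (b : Fin n → ℝ) : Prop := ∀ i, b i = 0 ∨ b i = 1

/-- The correlation polytope `COR(n) = conv {b bᵀ | b ∈ {0,1}^n}`. -/
def COR (n : ℕ) : Set (Matrix (Fin n) (Fin n) ℝ) :=
  convexHull ℝ {x | ∃ b : Fin n → ℝ, IsBinary b ∧ x = Matrix.vecMulVec b b}

/-- The polyhedron `Q(n) = {x | ⟨2 diag(a) - a aᵀ, x⟩ ≤ 1 for all a ∈ {0,1}^n}`. -/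
def outerQ (n : ℕ) : Set (Matrix (Fin n) (Fin n) ℝ) :=
  {x | ∀ a : Fin n → ℝ, IsBinary a →
    frob ((2 : ℝ) • Matrix.diagonal a - Matrix.vecMulVec a a) x ≤ 1}

end SDPInapprox

/-! The witness is the relaxation of `COR n` by bordered positive semidefinite matrices. Testing
positivity on `(1, -a)` gives the inequalities of `outerQ n`. At a vertex `b bᵀ` their slack is `(1
- |a ∩ b|) ^ 2`, the unique-disjointness matrix.

If `K` lies within `ℓ₁`-distance `ρ - 1` of the witness, the same inequalities with right-hand side
`ρ` hold on `K`. By Farkas' lemma (`HasEF.exists_slack_factorization`) an extended formulation of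
size `r` factorizes their slacks nonnegatively with `r + 1` terms. After division by `ρ` the slack
matrix is `1` on disjoint pairs and `1 - 1/ρ` on pairs meeting once.

Such a factorization is large by an entropy argument (`log_card_ge_of_factorization`). A fixed mask
`c` turns each rank-one term into a function on the cube. With few terms, the entropy bound makes
most coordinates nearly unbiased on average, hence opposite facet sums close in Hellinger distance.
The cut-and-paste identity for rank-one terms turns the gap `δ` at one intersection into a lower
bound on those distances. The result is `n / (16 ρ) ≤ log (r + 1)`. -/

namespace SDPInapprox

/-! ### Linear duality. -/

/-- **Farkas' lemma** for finitely many linear functionals on a real vector space. -/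
theorem farkas {V : Type*} [AddCommGroup V] [Module ℝ V] (r : ℕ) :
    ∀ (f : Fin r → V →ₗ[ℝ] ℝ) (g : V →ₗ[ℝ] ℝ),
      (∀ v, (∀ j, 0 ≤ f j v) → 0 ≤ g v) →
        ∃ l : Fin r → ℝ, (∀ j, 0 ≤ l j) ∧ ∀ v, g v = ∑ j, l j * f j v := by
  induction r with
  | zero =>
    intro f g h
    refine ⟨fun _ => 0, fun _ => le_rfl, fun v => ?_⟩
    have h1 := h v (fun j => j.elim0)
    have h2 := h (-v) (fun j => j.elim0)
    rw [map_neg] at h2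
    simp only [Finset.univ_eq_empty, Finset.sum_empty]
    linarith
  | succ r ih =>
    intro f g h
    by_cases hc : ∀ v, (∀ j : Fin r, 0 ≤ f j.succ v) → 0 ≤ g v
    · obtain ⟨l, hl, hg⟩ := ih (fun j => f j.succ) g hc
      refine ⟨Fin.cons 0 l, fun j => ?_, fun v => ?_⟩
      · refine Fin.cases ?_ (fun j => ?_) j
        · simp
        · simpa using hl j
      · rw [Fin.sum_univ_succ, hg v]
        simp
    · push Not at hc
      obtain ⟨w, hw, hgw⟩ := hc
      have hw0 : f 0 w < 0 := by
        by_contra hcon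
        push Not at hcon
        exact absurd (h w (fun j => Fin.cases hcon hw j)) (not_le.mpr hgw)
      set v₀ : V := (-(f 0 w))⁻¹ • w with hv₀
      have hpos : 0 < (-(f 0 w))⁻¹ := inv_pos.mpr (by linarith)
      have h0 : f 0 v₀ = -1 := by
        rw [hv₀, map_smul, smul_eq_mul, inv_neg, neg_mul, inv_mul_cancel₀ hw0.ne]
      have hf₀ : ∀ j : Fin r, 0 ≤ f j.succ v₀ := fun j => by
        rw [hv₀, map_smul, smul_eq_mul]
        exact mul_nonneg hpos.le (hw j)
      have hg₀ : g v₀ ≤ 0 := by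
        rw [hv₀, map_smul, smul_eq_mul]
        exact mul_nonpos_of_nonneg_of_nonpos hpos.le hgw.le
      -- The map `v ↦ v + f 0 v • v₀` projects onto the kernel of `f 0`, so composing with it
      -- eliminates one functional. The composed `g` is still nonnegative where the others are.
      obtain ⟨l, hl, hg⟩ := ih (fun j => f j.succ + (f j.succ v₀) • f 0) (g + (g v₀) • f 0) (by
        intro v hv
        have key := h (v + (f 0 v) • v₀) (fun j => by
          refine Fin.cases ?_ (fun j => ?_) j
          · rw [map_add, map_smul, h0]
            simp
          · have := hv j
            simp only [LinearMap.add_apply, LinearMap.smul_apply, smul_eq_mul] at this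
            rw [map_add, map_smul, smul_eq_mul]
            linarith)
        rw [map_add, map_smul, smul_eq_mul] at key
        simp only [LinearMap.add_apply, LinearMap.smul_apply, smul_eq_mul]
        linarith)
      refine ⟨Fin.cons (∑ j, l j * f j.succ v₀ - g v₀) l, fun j => ?_, fun v => ?_⟩
      · refine Fin.cases ?_ (fun j => ?_) j
        · rw [Fin.cons_zero]
          have := Finset.sum_nonneg (fun j (_ : j ∈ Finset.univ) => mul_nonneg (hl j) (hf₀ j))
          linarith
        · simpa using hl j
      · have := hg v
        simp only [LinearMap.add_apply, LinearMap.smul_apply, smul_eq_mul, mul_add,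
          Finset.sum_add_distrib] at this
        rw [Fin.sum_univ_succ]
        simp only [Fin.cons_zero, Fin.cons_succ]
        have h3 : ∑ j, l j * (f j.succ v₀ * f 0 v) = (∑ j, l j * f j.succ v₀) * f 0 v := by
          rw [Finset.sum_mul]
          exact Finset.sum_congr rfl fun j _ => by ring
        rw [h3] at this
        linarith

/-! ### Entropy on the Boolean cube -/

section Cube

variable {ι : Type*} [Fintype ι] [DecidableEq ι]

/-- The sum of `F` over the facet `x i = s` of the cube, every point being counted twice. -/
def facetSum (F : (ι → Bool) → ℝ) (i : ι) (s : Bool) : ℝ :=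
  ∑ x, F (Function.update x i s)

lemma facetSum_nonneg {F : (ι → Bool) → ℝ} (hF : ∀ x, 0 ≤ F x) (i : ι) (s : Bool) :
    0 ≤ facetSum F i s :=
  Finset.sum_nonneg fun _ _ => hF _

/-- Flipping the `i`-th coordinate of a point of the cube. -/
def flipPerm (i : ι) : Equiv.Perm (ι → Bool) :=
  Function.Involutive.toPerm (fun x => Function.update x i (!x i)) (fun x => by simp)

lemma facetSum_add (F : (ι → Bool) → ℝ) (i : ι) :
    facetSum F i true + facetSum F i false = 2 * ∑ x, F x := by
  have h : ∀ x : ι → Bool, F (Function.update x i true) + F (Function.update x i false)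
      = F x + F (flipPerm i x) := by
    intro x
    have hx : Function.update x i (x i) = x := Function.update_eq_self i x
    change _ = _ + F (Function.update x i (!x i))
    cases hxi : x i <;> rw [hxi] at hx <;> simp [hx, add_comm]
  rw [facetSum, facetSum, ← Finset.sum_add_distrib, Finset.sum_congr rfl fun x _ => h x,
    Finset.sum_add_distrib, Equiv.sum_comp (flipPerm i) F]
  ring

lemma sum_mul_coord (F : (ι → Bool) → ℝ) (i : ι) (h : Bool → ℝ) :
    2 * ∑ x, F x * h (x i) = facetSum F i true * h true + facetSum F i false * h false := by
  rw [← facetSum_add (fun x => F x * h (x i)) i]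
  simp [facetSum, Finset.sum_mul]

lemma le_facetSum {F : (ι → Bool) → ℝ} (hF : ∀ x, 0 ≤ F x) (i : ι) (x : ι → Bool) :
    F x ≤ facetSum F i (x i) := by
  have := Finset.single_le_sum (f := fun y => F (Function.update y i (x i)))
    (fun y _ => hF _) (Finset.mem_univ x)
  simpa [facetSum] using this

/-- This is `log t ≤ t - 1` at `t = 1 / √(2p)`; the square root produces Hellinger terms instead of
a quadratic bound. -/
lemma mul_log_two_mul_ge {p : ℝ} (hp : 0 ≤ p) :
    2 * p - √2 * √p ≤ p * (Real.log 2 + Real.log p) := by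
  rcases hp.eq_or_lt with rfl | hp
  · simp
  have h2 : (0 : ℝ) < √(2 * p) := Real.sqrt_pos.mpr (by linarith)
  have h := Real.log_le_sub_one_of_pos (inv_pos.mpr h2)
  rw [Real.log_inv, Real.log_sqrt (by linarith), Real.log_mul two_ne_zero hp.ne'] at h
  have h3 : p * (√(2 * p))⁻¹ = √(2 * p) / 2 := by
    have := Real.mul_self_sqrt (show 0 ≤ 2 * p by linarith)
    rw [← div_eq_mul_inv, div_eq_div_iff h2.ne' two_ne_zero, this, mul_comm]
  have h4 := mul_le_mul_of_nonneg_left h hp.le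
  rw [mul_sub, h3, Real.sqrt_mul zero_le_two] at h4
  linarith

/-- Adding the previous bound for `p` and `q` leaves a defect of `(√2 - √p - √q) ^ 2 / 2`. -/
lemma binary_entropy_le {p q : ℝ} (hp : 0 ≤ p) (hq : 0 ≤ q) (hpq : p + q = 1) :
    (√p - √q) ^ 2 / 2 - Real.log 2 ≤ p * Real.log p + q * Real.log q := by
  have h1 := mul_log_two_mul_ge hp
  have h2 := mul_log_two_mul_ge hq
  have h3 : (p + q) * Real.log 2 = Real.log 2 := by rw [hpq, one_mul]
  have e1 := Real.mul_self_sqrt hp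
  have e2 := Real.mul_self_sqrt hq
  have e3 := Real.mul_self_sqrt (zero_le_two (α := ℝ))
  nlinarith [sq_nonneg (√2 - √p - √q)]

lemma facet_entropy_le {F : (ι → Bool) → ℝ} (hF : ∀ x, 0 ≤ F x) (i : ι) {T : ℝ} (hT : 0 < T)
    (hsum : ∑ x, F x = T) :
    (√(facetSum F i true) - √(facetSum F i false)) ^ 2 / 4 - T * Real.log 2 ≤
      ∑ x, F x * Real.log (facetSum F i (x i) / (2 * T)) := by
  have hadd := facetSum_add F i
  rw [hsum] at hadd
  have h2T : 0 < 2 * T := by linarith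
  have hm := fun s => facetSum_nonneg hF i s
  have hb := binary_entropy_le (div_nonneg (hm true) h2T.le) (div_nonneg (hm false) h2T.le)
    (by rw [← add_div, hadd, div_self h2T.ne'])
  have hs := sum_mul_coord F i (fun s => Real.log (facetSum F i s / (2 * T)))
  rw [Real.sqrt_div (hm _), Real.sqrt_div (hm _), ← sub_div, div_pow,
    Real.sq_sqrt h2T.le] at hb
  have := mul_le_mul_of_nonneg_left hb hT.le
  have e1 : ∀ a b : ℝ, T * (a / (2 * T) * b) = a * b / 2 := fun a b => by field_simp
  have e2 : ∀ a : ℝ, T * (a / (2 * T) / 2) = a / 4 := fun a => by field_simp; ring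
  rw [mul_add, mul_sub, e1, e1, e2] at this
  linarith

/-- Superadditivity of entropy over the coordinates of the cube, combined with a Hellinger bound
for the entropy of a bit. -/
lemma sum_facet_sq_le {F : (ι → Bool) → ℝ} (hF : ∀ x, 0 ≤ F x) (hF1 : ∀ x, F x ≤ 1) :
    ∑ i, (√(facetSum F i true) - √(facetSum F i false)) ^ 2 / 4 ≤
      (∑ x, F x) * (Fintype.card ι * Real.log 2 - Real.log (∑ x, F x)) := by
  set T := ∑ x, F x with hTdef
  rcases (Finset.sum_nonneg fun x (_ : x ∈ Finset.univ) => hF x).eq_or_lt with h0 | hT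
  · have hz : ∀ x, F x = 0 := fun x =>
      (Finset.sum_eq_zero_iff_of_nonneg (fun x _ => hF x)).mp h0.symm x (Finset.mem_univ x)
    have hT0 : T = 0 := h0.symm
    simp [facetSum, hz, hT0]
  rw [← hTdef] at hT
  set P : ι → Bool → ℝ := fun i s => facetSum F i s / (2 * T) with hP
  have hP0 : ∀ i s, 0 ≤ P i s := fun i s => div_nonneg (facetSum_nonneg hF i s) (by linarith)
  have hP1 : ∀ i, ∑ s, P i s = 1 := fun i => by
    have := facetSum_add F i
    rw [← hTdef] at this
    rw [Fintype.sum_bool, hP]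
    simp only
    rw [← add_div, this, div_self (by linarith)]
  have hG : ∑ x : ι → Bool, T * ∏ i, P i (x i) = T := by
    rw [← Finset.mul_sum, ← Fintype.prod_sum, Finset.prod_congr rfl fun i _ => hP1 i,
      Finset.prod_const_one, mul_one]
  -- Pointwise Gibbs inequality for `F` against `T` times the product of its marginals. The term `F
  -- x * log (F x)` is nonpositive because `F x ≤ 1`, and is dropped.
  have hpt : ∀ x, F x * (Real.log T + ∑ i, Real.log (P i (x i))) ≤ T * ∏ i, P i (x i) - F x := by
    intro x
    rcases (hF x).eq_or_lt with h | h
    · rw [← h]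
      simpa using mul_nonneg hT.le (Finset.prod_nonneg fun i _ => hP0 i (x i))
    · have hPx : ∀ i, 0 < P i (x i) := fun i =>
        div_pos (h.trans_le (le_facetSum hF i x)) (by linarith)
      have hprod : 0 < ∏ i, P i (x i) := Finset.prod_pos fun i _ => hPx i
      have hGx : 0 < T * ∏ i, P i (x i) := mul_pos hT hprod
      rw [← Real.log_prod (fun i _ => (hPx i).ne'), ← Real.log_mul hT.ne' hprod.ne']
      have h1 := Real.log_le_sub_one_of_pos (div_pos hGx h)
      rw [Real.log_div hGx.ne' h.ne'] at h1
      have h2 := mul_le_mul_of_nonneg_left h1 h.le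
      have h3 : F x * ((T * ∏ i, P i (x i)) / F x - 1) = T * ∏ i, P i (x i) - F x := by
        field_simp
      have h4 := mul_nonpos_of_nonneg_of_nonpos h.le (Real.log_nonpos h.le (hF1 x))
      rw [h3] at h2
      linarith
  have hsum := Finset.sum_le_sum fun x (_ : x ∈ Finset.univ) => hpt x
  rw [Finset.sum_sub_distrib, hG, ← hTdef, sub_self] at hsum
  have hexp : ∑ x, F x * (Real.log T + ∑ i, Real.log (P i (x i)))
      = T * Real.log T + ∑ i, ∑ x, F x * Real.log (P i (x i)) := by
    rw [Finset.sum_comm, hTdef, Finset.sum_mul, ← Finset.sum_add_distrib]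
    exact Finset.sum_congr rfl fun x _ => by rw [mul_add, Finset.mul_sum]
  rw [hexp] at hsum
  have hent := Finset.sum_le_sum fun i (_ : i ∈ Finset.univ) =>
    facet_entropy_le hF i hT hTdef.symm
  rw [Finset.sum_sub_distrib] at hent
  simp only [Finset.sum_const, Finset.card_univ, nsmul_eq_mul] at hent
  change _ ≤ ∑ i, ∑ x, F x * Real.log (P i (x i)) at hent
  linarith

/-- The distribution `T k / N` has entropy at most the logarithm of the number of its values. -/
lemma sum_mul_sub_log_le {κ : Type*} [Fintype κ] (T : κ → ℝ) (hT : ∀ k, 0 ≤ T k) {N : ℝ}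
    (hN : 0 < N) (hsum : ∑ k, T k = N) :
    ∑ k, T k * (Real.log N - Real.log (T k)) ≤ N * Real.log (Fintype.card κ) := by
  have hne : Nonempty κ := by
    by_contra h
    rw [not_nonempty_iff] at h
    simp at hsum
    linarith
  have hr : (0 : ℝ) < Fintype.card κ := by exact_mod_cast Fintype.card_pos
  have hpt : ∀ k, T k * (Real.log N - Real.log (T k)) ≤
      N / Fintype.card κ - T k + T k * Real.log (Fintype.card κ) := by
    intro k
    rcases (hT k).eq_or_lt with h | h
    · rw [← h]
      simp only [zero_mul, sub_zero, add_zero]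
      positivity
    · have h1 := Real.log_le_sub_one_of_pos (show 0 < N / (Fintype.card κ * T k) by positivity)
      rw [Real.log_div hN.ne' (by positivity), Real.log_mul hr.ne' h.ne'] at h1
      have h2 := mul_le_mul_of_nonneg_left h1 h.le
      have h3 : T k * (N / (Fintype.card κ * T k) - 1) = N / Fintype.card κ - T k := by
        field_simp
      rw [h3] at h2
      linarith
  refine (Finset.sum_le_sum fun k _ => hpt k).trans ?_
  rw [Finset.sum_add_distrib, Finset.sum_sub_distrib, ← Finset.sum_mul, hsum]
  simp only [Finset.sum_const, Finset.card_univ, nsmul_eq_mul]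
  rw [mul_div_cancel₀ _ hr.ne']
  linarith

end Cube

/-! ### Nonnegative factorizations of unique-disjointness matrices. -/

section Disjointness

variable {ι : Type*} [Fintype ι] [DecidableEq ι]

/-- The restriction of `x` to the coordinates on which `c` takes the value `s`. -/
def maskEq (c : ι → Bool) (s : Bool) (x : ι → Bool) : ι → Bool :=
  fun j => x j && (c j == s)

/-- Exchanging the coordinates outside the support of `c` of two points of the cube. -/
def crossPerm (c : ι → Bool) : Equiv.Perm ((ι → Bool) × (ι → Bool)) :=
  Function.Involutive.toPerm
    (fun p => (fun j => if c j then p.1 j else p.2 j, fun j => if c j then p.2 j else p.1 j))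
    (fun p => by ext j <;> cases h : c j <;> simp [h])

/-- The two factors read disjoint sets of coordinates, hence are independent for uniform `x`;
`crossPerm` recombines a pair of points accordingly. -/
lemma sum_mask_mul (c : ι → Bool) (f g : (ι → Bool) → ℝ) :
    (Fintype.card (ι → Bool) : ℝ) * ∑ x, f (maskEq c true x) * g (maskEq c false x) =
      (∑ x, f (maskEq c true x)) * ∑ x, g (maskEq c false x) := by
  have h1 := Equiv.sum_comp (crossPerm c)
    (fun p => f (maskEq c true p.1) * g (maskEq c false p.1))
  rw [Fintype.sum_prod_type, Fintype.sum_prod_type] at h1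
  simp only [Finset.sum_const, Finset.card_univ, nsmul_eq_mul] at h1
  rw [Finset.sum_mul_sum, Finset.mul_sum, ← h1]
  refine Finset.sum_congr rfl fun x _ => Finset.sum_congr rfl fun y _ => ?_
  congr 2 <;> ext j <;> cases h : c j <;>
    simp [maskEq, crossPerm, Function.Involutive.toPerm, h]

/-- The sum of `u a * v b` over the disjoint pairs supported on `c` and its complement, with the
`i`-th bits of `a` and `b` replaced by `s` and `t`. -/
def pairSum (u v : (ι → Bool) → ℝ) (c : ι → Bool) (i : ι) (s t : Bool) : ℝ :=
  ∑ x, u (Function.update (maskEq c true x) i s) * v (Function.update (maskEq c false x) i t)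

/-- Cut-and-paste: by independence each sum is a factor depending on `s` times one depending on `t`.
-/
lemma pairSum_mul_pairSum (u v : (ι → Bool) → ℝ) (c : ι → Bool) (i : ι) :
    pairSum u v c i false false * pairSum u v c i true true =
      pairSum u v c i true false * pairSum u v c i false true := by
  have hN : (Fintype.card (ι → Bool) : ℝ) ≠ 0 := by exact_mod_cast Fintype.card_ne_zero
  have h := fun s t => sum_mask_mul c (fun a => u (Function.update a i s))
    (fun b => v (Function.update b i t))
  have key : (Fintype.card (ι → Bool) : ℝ) ^ 2 *
      (pairSum u v c i false false * pairSum u v c i true true) =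
      (Fintype.card (ι → Bool) : ℝ) ^ 2 *
        (pairSum u v c i true false * pairSum u v c i false true) := by
    calc _ = ((Fintype.card (ι → Bool) : ℝ) * pairSum u v c i false false) *
          ((Fintype.card (ι → Bool) : ℝ) * pairSum u v c i true true) := by ring
      _ = ((Fintype.card (ι → Bool) : ℝ) * pairSum u v c i true false) *
          ((Fintype.card (ι → Bool) : ℝ) * pairSum u v c i false true) := by
        unfold pairSum
        rw [h, h, h, h]
        ring
      _ = _ := by ring
  exact mul_left_cancel₀ (pow_ne_zero 2 hN) key

/-- The restriction of the rank-one matrix `u ⊗ v` to the pairs obtained by distributing the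
coordinates of `x` according to `c`. -/
def split (u v : (ι → Bool) → ℝ) (c x : ι → Bool) : ℝ :=
  u (maskEq c true x) * v (maskEq c false x)

lemma facetSum_split (u v : (ι → Bool) → ℝ) (c : ι → Bool) (i : ι) (s : Bool) :
    facetSum (split u v c) i s = pairSum u v c i (s && c i) (s && !c i) := by
  refine Finset.sum_congr rfl fun x _ => ?_
  unfold split
  congr 2 <;> ext j <;> by_cases hj : j = i
  · subst hj; cases h : c j <;> simp [maskEq, h]
  · simp [maskEq, hj]
  · subst hj; cases h : c j <;> simp [maskEq, h]
  · simp [maskEq, hj]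

/-- The mask matters at `i` only through bits that are overwritten. So `c` and its flip share the
sum with both bits off, and one compares it with `(true, false)`, the other with `(false, true)`. -/
lemma pairSum_flip (u v : (ι → Bool) → ℝ) (c : ι → Bool) (i : ι) (s t : Bool) :
    pairSum u v (flipPerm i c) i s t = pairSum u v c i s t := by
  refine Finset.sum_congr rfl fun x _ => ?_
  congr 2 <;> ext j <;> by_cases hj : j = i
  · subst hj; simp
  · simp [maskEq, hj, flipPerm, Function.Involutive.toPerm]
  · subst hj; simp
  · simp [maskEq, hj, flipPerm, Function.Involutive.toPerm]

variable {κ : Type*} [Fintype κ]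

/-- The sum over `k` of the squared Hellinger distances between the two facets orthogonal to `i`. -/
noncomputable def facetDist (u v : κ → (ι → Bool) → ℝ) (i : ι) (c : ι → Bool) : ℝ :=
  ∑ k, (√(facetSum (split (u k) (v k) c) i true) -
    √(facetSum (split (u k) (v k) c) i false)) ^ 2

/-- The two squared distances from the `(false, false)` sums are at least half the squared distance
between the `(true, false)` and `(false, true)` sums. Cut-and-paste rewrites the cross term there as
`√m₀₀ √m₁₁`, and Cauchy–Schwarz over `k` bounds its total by `N √(1 - δ)`. -/
lemma facetDist_add_flip_ge (u v : κ → (ι → Bool) → ℝ) (hu : ∀ k a, 0 ≤ u k a)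
    (hv : ∀ k a, 0 ≤ v k a) {δ : ℝ} (hδ : δ ≤ 1)
    (hdisj : ∀ a b, (∀ j, (a j && b j) = false) → ∑ k, u k a * v k b = 1)
    (hone : ∀ a b i, a i = true → b i = true → (∀ j, j ≠ i → (a j && b j) = false) →
      ∑ k, u k a * v k b = 1 - δ) (i : ι) (c : ι → Bool) :
    (Fintype.card (ι → Bool) : ℝ) * δ / 2 ≤ facetDist u v i c + facetDist u v i (flipPerm i c) := by
  set N : ℝ := (Fintype.card (ι → Bool) : ℝ) with hN
  have hN0 : 0 ≤ N := Nat.cast_nonneg _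
  set m : κ → Bool → Bool → ℝ := fun k s t => pairSum (u k) (v k) c i s t with hm
  have hm0 : ∀ k s t, 0 ≤ m k s t := fun k s t =>
    Finset.sum_nonneg fun x _ => mul_nonneg (hu _ _) (hv _ _)
  have hsum : ∀ s t, (s && t) = false → ∑ k, m k s t = N := by
    intro s t hst
    simp only [hm, pairSum]
    rw [Finset.sum_comm, Finset.sum_congr rfl fun x _ => hdisj _ _ ?_]
    · simp [hN]
    · intro j
      by_cases hj : j = i
      · subst hj; simpa using hst
      · cases h : c j <;> simp [maskEq, hj, h]
  have hsum' : ∑ k, m k true true = N * (1 - δ) := by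
    simp only [hm, pairSum]
    rw [Finset.sum_comm, Finset.sum_congr rfl fun x _ => hone _ _ i ?_ ?_ ?_]
    · simp [hN, mul_sub]
    · simp
    · simp
    · intro j hj
      cases h : c j <;> simp [maskEq, hj, h]
  have hpair : facetDist u v i c + facetDist u v i (flipPerm i c) =
      ∑ k, ((√(m k true false) - √(m k false false)) ^ 2 +
        (√(m k false true) - √(m k false false)) ^ 2) := by
    rw [Finset.sum_add_distrib]
    have hflip : flipPerm i c i = !c i := by simp [flipPerm, Function.Involutive.toPerm]
    simp only [facetDist, facetSum_split, pairSum_flip, hflip, hm]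
    cases c i <;> simp [add_comm]
  have hpt : ∀ k, (m k true false + m k false true) / 2 - √(m k false false) * √(m k true true) ≤
      (√(m k true false) - √(m k false false)) ^ 2 +
        (√(m k false true) - √(m k false false)) ^ 2 := by
    intro k
    have hprod : √(m k false false) * √(m k true true) = √(m k true false) * √(m k false true) := by
      rw [← Real.sqrt_mul (hm0 _ _ _), ← Real.sqrt_mul (hm0 _ _ _)]
      exact congrArg Real.sqrt (pairSum_mul_pairSum (u k) (v k) c i)
    have e1 := Real.sq_sqrt (hm0 k true false)
    have e2 := Real.sq_sqrt (hm0 k false true)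
    rw [hprod]
    nlinarith [sq_nonneg (√(m k true false) + √(m k false true) - 2 * √(m k false false))]
  rw [hpair]
  refine le_trans ?_ (Finset.sum_le_sum fun k _ => hpt k)
  have hcs := Real.sum_sqrt_mul_sqrt_le Finset.univ (fun k => hm0 k false false)
    (fun k => hm0 k true true)
  rw [hsum _ _ rfl, hsum', Real.sqrt_mul hN0, ← mul_assoc, Real.mul_self_sqrt hN0] at hcs
  have hsq : √(1 - δ) ≤ 1 - δ / 2 := by
    rw [Real.sqrt_le_left (by linarith)]
    nlinarith [sq_nonneg δ]
  have := mul_le_mul_of_nonneg_left hsq hN0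
  rw [Finset.sum_sub_distrib, ← Finset.sum_div, Finset.sum_add_distrib, hsum _ _ rfl,
    hsum _ _ rfl]
  linarith

/-- A nonnegative factorization of a matrix that is `1` on disjoint pairs and `1 - δ` on pairs
with exactly one common element has size at least `exp (δ n / 16)`. -/
theorem log_card_ge_of_factorization (u v : κ → (ι → Bool) → ℝ) (hu : ∀ k a, 0 ≤ u k a)
    (hv : ∀ k a, 0 ≤ v k a) {δ : ℝ} (hδ : δ ≤ 1)
    (hdisj : ∀ a b, (∀ j, (a j && b j) = false) → ∑ k, u k a * v k b = 1)
    (hone : ∀ a b i, a i = true → b i = true → (∀ j, j ≠ i → (a j && b j) = false) →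
      ∑ k, u k a * v k b = 1 - δ) :
    δ * Fintype.card ι / 16 ≤ Real.log (Fintype.card κ) := by
  set N : ℝ := (Fintype.card (ι → Bool) : ℝ) with hN
  have hNpos : 0 < N := Nat.cast_pos.mpr Fintype.card_pos
  have hlogN : Real.log N = Fintype.card ι * Real.log 2 := by
    rw [hN]
    simp
  have hsplit0 : ∀ c k x, 0 ≤ split (u k) (v k) c x := fun c k x => mul_nonneg (hu _ _) (hv _ _)
  have hsplit : ∀ c x, ∑ k, split (u k) (v k) c x = 1 := fun c x =>
    hdisj _ _ fun j => by cases h : c j <;> simp [maskEq, h]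
  have hub : ∀ c, ∑ i, facetDist u v i c / 4 ≤ N * Real.log (Fintype.card κ) := by
    intro c
    refine le_trans ?_ (sum_mul_sub_log_le (fun k => ∑ x, split (u k) (v k) c x)
      (fun k => Finset.sum_nonneg fun x _ => hsplit0 c k x) hNpos ?_)
    · simp only [facetDist, Finset.sum_div]
      rw [Finset.sum_comm]
      refine Finset.sum_le_sum fun k _ => ?_
      rw [hlogN]
      refine sum_facet_sq_le (hsplit0 c k) fun x => ?_
      rw [← hsplit c x]
      exact Finset.single_le_sum (f := fun k => split (u k) (v k) c x)
        (fun k _ => hsplit0 c k x) (Finset.mem_univ k)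
    · rw [Finset.sum_comm, Finset.sum_congr rfl fun x _ => hsplit c x]
      simp [hN]
  have hlb : ∀ i, N * (N * δ / 2) ≤ 2 * ∑ c, facetDist u v i c := by
    intro i
    have h1 := Finset.sum_le_sum fun c (_ : c ∈ Finset.univ) =>
      facetDist_add_flip_ge u v hu hv hδ hdisj hone i c
    rw [Finset.sum_add_distrib, Equiv.sum_comp (flipPerm i) (facetDist u v i)] at h1
    simp only [Finset.sum_const, Finset.card_univ, nsmul_eq_mul] at h1
    linarith
  have h1 := Finset.sum_le_sum fun c (_ : c ∈ Finset.univ) => hub c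
  have h2 := Finset.sum_le_sum fun i (_ : i ∈ Finset.univ) => hlb i
  rw [Finset.sum_comm] at h1
  simp only [Finset.sum_const, Finset.card_univ, nsmul_eq_mul, ← Finset.sum_div,
    ← Finset.mul_sum] at h1 h2
  rw [← hN] at h1
  -- The `16` collects the `4` of the entropy bound, the `2` in `δ / 2`, and the `2` from pairing
  -- `c` with its flip.
  have h3 : N * N * (δ * Fintype.card ι / 16) ≤ N * N * Real.log (Fintype.card κ) := by
    linarith
  exact le_of_mul_le_mul_left h3 (mul_pos hNpos hNpos)

end Disjointness

/-! ### Frobenius products and Yannakakis' factorization. -/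

lemma frob_add_right {m : ℕ} (A B C : Matrix (Fin m) (Fin m) ℝ) :
    frob A (B + C) = frob A B + frob A C := by
  simp [frob, mul_add, Finset.sum_add_distrib]

lemma frob_smul_right {m : ℕ} (A B : Matrix (Fin m) (Fin m) ℝ) (c : ℝ) :
    frob A (c • B) = c * frob A B := by
  simp only [frob, Finset.mul_sum, Matrix.smul_apply, smul_eq_mul]
  exact Finset.sum_congr rfl fun i _ => Finset.sum_congr rfl fun j _ => by ring

lemma frob_add_left {m : ℕ} (A B C : Matrix (Fin m) (Fin m) ℝ) :
    frob (A + B) C = frob A C + frob B C := by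
  simp [frob, add_mul, Finset.sum_add_distrib]

lemma frob_single {m : ℕ} (p q : Fin m) (c : ℝ) (Y : Matrix (Fin m) (Fin m) ℝ) :
    frob (Matrix.single p q c) Y = c * Y p q := by
  unfold frob
  rw [Finset.sum_eq_single p, Finset.sum_eq_single q]
  · simp
  · intro j _ hj
    simp [Matrix.single_apply_of_col_ne _ _ hj.symm]
  · simp
  · intro i _ hi
    refine Finset.sum_eq_zero fun j _ => ?_
    simp [Matrix.single_apply_of_row_ne hi.symm]
  · simp

lemma frob_le_l1Norm {m : ℕ} {A : Matrix (Fin m) (Fin m) ℝ} (hA : ∀ i j, |A i j| ≤ 1)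
    (B : Matrix (Fin m) (Fin m) ℝ) : frob A B ≤ l1Norm B := by
  refine Finset.sum_le_sum fun i _ => Finset.sum_le_sum fun j _ => ?_
  refine (le_abs_self _).trans ?_
  rw [abs_mul]
  exact mul_le_of_le_one_left (abs_nonneg _) (hA i j)

/-- Slack variables make the set of sizes nonempty, so the infimum is attained and not the default
`0`. -/
lemma IsPolyhedron.hasEF_xc {n : ℕ} {K : Set (Matrix (Fin n) (Fin n) ℝ)} (hK : IsPolyhedron K) :
    HasEF K (xc K) := by
  refine Nat.sInf_mem (s := {r | HasEF K r}) ?_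
  obtain ⟨m, A, b, rfl⟩ := hK
  refine ⟨m, m, A, fun i => Pi.single i 1, b, ?_⟩
  ext x
  simp only [Set.mem_ofPred_eq, single_one_dotProduct]
  constructor
  · intro h
    exact ⟨fun i => b i - frob (A i) x, fun i => by linarith [h i], fun i => by ring⟩
  · rintro ⟨y, hy, h⟩ i
    linarith [hy i, h i]

/-- The homogenization of a linear system. -/
def homogenization {n r k : ℕ} (E : Fin k → Matrix (Fin n) (Fin n) ℝ) (F : Fin k → Fin r → ℝ)
    (g : Fin k → ℝ) : Submodule ℝ (Matrix (Fin n) (Fin n) ℝ × (Fin r → ℝ) × ℝ) where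
  carrier := {p | ∀ i, frob (E i) p.1 + F i ⬝ᵥ p.2.1 = g i * p.2.2}
  zero_mem' i := by simp [frob]
  add_mem' {p q} hp hq i := by
    have h1 := hp i
    have h2 := hq i
    simp only [Prod.fst_add, Prod.snd_add, frob_add_right, dotProduct_add]
    linarith
  smul_mem' c p hp i := by
    have h1 := hp i
    simp only [Prod.smul_fst, Prod.smul_snd, frob_smul_right, dotProduct_smul, smul_eq_mul]
    rw [← mul_add, h1]
    ring

/-- **Yannakakis' factorization**: an extended formulation of size `r` of a nonempty set `K`
factorizes the slacks of all valid inequalities through `ℝ^{r+1}_+`. -/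
theorem HasEF.exists_slack_factorization {n r : ℕ} {K : Set (Matrix (Fin n) (Fin n) ℝ)}
    (hK : HasEF K r) (hne : K.Nonempty) :
    ∃ y : Matrix (Fin n) (Fin n) ℝ → Fin (r + 1) → ℝ, (∀ x ∈ K, ∀ j, 0 ≤ y x j) ∧
      ∀ A ρ, (∀ x ∈ K, frob A x ≤ ρ) → ∃ l : Fin (r + 1) → ℝ, (∀ j, 0 ≤ l j) ∧
        ∀ x ∈ K, ρ - frob A x = ∑ j, l j * y x j := by
  obtain ⟨k, E, F, g, rfl⟩ := hK
  have hex : ∀ x : Matrix (Fin n) (Fin n) ℝ, ∃ y : Fin r → ℝ,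
      x ∈ {x | ∃ y : Fin r → ℝ, (∀ j, 0 ≤ y j) ∧ ∀ i, frob (E i) x + F i ⬝ᵥ y = g i} →
        (∀ j, 0 ≤ y j) ∧ ∀ i, frob (E i) x + F i ⬝ᵥ y = g i := by
    intro x
    by_cases h : ∃ y : Fin r → ℝ, (∀ j, 0 ≤ y j) ∧ ∀ i, frob (E i) x + F i ⬝ᵥ y = g i
    · exact h.imp fun y hy _ => hy
    · exact ⟨0, fun h' => absurd h' h⟩
  choose y hy using hex
  refine ⟨fun x => Fin.cons 1 (y x), fun x hx j => ?_, fun A ρ hA => ?_⟩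
  · refine Fin.cases ?_ (fun j => ?_) j
    · simp
    · simpa using (hy x hx).1 j
  obtain ⟨x₀, y₀, hy₀, hx₀⟩ := hne
  let W := homogenization E F g
  let coord : Fin r → W →ₗ[ℝ] ℝ := fun j =>
    { toFun := fun p => p.1.2.1 j, map_add' := fun _ _ => rfl, map_smul' := fun _ _ => rfl }
  let last : W →ₗ[ℝ] ℝ :=
    { toFun := fun p => p.1.2.2, map_add' := fun _ _ => rfl, map_smul' := fun _ _ => rfl }
  let slack : W →ₗ[ℝ] ℝ :=
    { toFun := fun p => ρ * p.1.2.2 - frob A p.1.1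
      map_add' := fun p q => by
        simp only [Submodule.coe_add, Prod.fst_add, Prod.snd_add, frob_add_right]
        ring
      map_smul' := fun c p => by
        simp only [Submodule.coe_smul, Prod.smul_fst, Prod.smul_snd, frob_smul_right, smul_eq_mul,
          RingHom.id_apply]
        ring }
  obtain ⟨l, hl, hls⟩ := farkas (r + 1) (Fin.cons last coord) slack (by
    rintro ⟨⟨x, z, t⟩, hp⟩ hnn
    have ht : 0 ≤ t := hnn 0
    have hz : ∀ j, 0 ≤ z j := fun j => hnn j.succ
    have hp' : ∀ i, frob (E i) x + F i ⬝ᵥ z = g i * t := hp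
    change 0 ≤ ρ * t - frob A x
    -- Adding a multiple of a homogeneous solution to a point of `K` and rescaling stays in `K`.
    -- This treats `t = 0`, the recession directions, along with `t > 0`.
    have hray : ∀ s : ℝ, 0 ≤ s → frob A x₀ + s * frob A x ≤ ρ * (1 + s * t) := by
      intro s hs
      have hpos : 0 < 1 + s * t := by positivity
      have hmem := hA ((1 + s * t)⁻¹ • (x₀ + s • x))
        ⟨(1 + s * t)⁻¹ • (y₀ + s • z), fun j => ?_, fun i => ?_⟩
      · rw [frob_smul_right, frob_add_right, frob_smul_right, inv_mul_le_iff₀ hpos] at hmem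
        linarith
      · have h1 := hy₀ j
        have h2 := hz j
        simp only [Pi.smul_apply, Pi.add_apply, smul_eq_mul]
        positivity
      · rw [frob_smul_right, frob_add_right, frob_smul_right, dotProduct_smul, dotProduct_add,
          dotProduct_smul, smul_eq_mul, smul_eq_mul, ← mul_add, inv_mul_eq_iff_eq_mul₀ hpos.ne']
        linear_combination hx₀ i + s * hp' i
    by_contra hneg
    push Not at hneg
    have h0 := hray 0 le_rfl
    -- At this `s` the violation along the ray exceeds the slack of `x₀` by exactly `1`.
    have h1 := hray ((ρ - frob A x₀ + 1) / (frob A x - ρ * t))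
      (div_nonneg (by linarith) (by linarith))
    have h2 : (ρ - frob A x₀ + 1) / (frob A x - ρ * t) * (frob A x - ρ * t) = ρ - frob A x₀ + 1 :=
      div_mul_cancel₀ _ (by linarith)
    linarith)
  refine ⟨l, hl, fun x hx => ?_⟩
  have hW : (x, y x, (1 : ℝ)) ∈ W := fun i => by
    simpa using (hy x hx).2 i
  have h := hls ⟨_, hW⟩
  rw [Fin.sum_univ_succ] at h
  rw [Fin.sum_univ_succ]
  simpa [coord, last, slack] using h

/-! ### The spectrahedron -/

/-- The spectrahedral relaxation of the correlation polytope: the matrices `x` that, bordered by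
their diagonal and a corner entry `1`, become positive semidefinite. -/
def corSDP (n : ℕ) : Set (Matrix (Fin n) (Fin n) ℝ) :=
  {x | ∃ Y : Matrix (Fin (n + 1)) (Fin (n + 1)) ℝ, Y.PosSemidef ∧ Y 0 0 = 1 ∧
    (∀ i, Y 0 i.succ = x i i) ∧ ∀ i j, Y i.succ j.succ = x i j}

/-- The symmetric matrix `F` with `⟨F, Y⟩ = Y p q` for symmetric `Y`. -/
noncomputable def symSingle {m : ℕ} (p q : Fin m) : Matrix (Fin m) (Fin m) ℝ :=
  Matrix.single p q (1 / 2) + Matrix.single q p (1 / 2)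

lemma symSingle_isSymm {m : ℕ} (p q : Fin m) : (symSingle p q).IsSymm := by
  rw [Matrix.IsSymm, symSingle, Matrix.transpose_add, Matrix.transpose_single,
    Matrix.transpose_single, add_comm]

lemma frob_symSingle {m : ℕ} (p q : Fin m) {Y : Matrix (Fin m) (Fin m) ℝ} (hY : Y.IsHermitian) :
    frob (symSingle p q) Y = Y p q := by
  have h : Y q p = Y p q := by simpa using hY.apply p q
  rw [symSingle, frob_add_left, frob_single, frob_single, h]
  ring

lemma corSDP_hasSemidefiniteEF (n : ℕ) : HasSemidefiniteEF (corSDP n) (n + 1) := by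
  let κ := Option (Fin n ⊕ Fin n × Fin n)
  let E : κ → Matrix (Fin n) (Fin n) ℝ := fun c => match c with
    | none => 0
    | some (.inl i) => Matrix.single i i (-1)
    | some (.inr (i, j)) => Matrix.single i j (-1)
  let F : κ → Matrix (Fin (n + 1)) (Fin (n + 1)) ℝ := fun c => match c with
    | none => symSingle 0 0
    | some (.inl i) => symSingle 0 i.succ
    | some (.inr (i, j)) => symSingle i.succ j.succ
  let g : κ → ℝ := fun c => match c with
    | none => 1
    | some _ => 0
  let e := (Fintype.equivFin κ).symm
  refine ⟨Fintype.card κ, E ∘ e, F ∘ e, g ∘ e, fun c => ?_, ?_⟩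
  · change (F (e c)).IsSymm
    rcases e c with _ | i | ⟨i, j⟩ <;> exact symSingle_isSymm _ _
  · ext x
    refine exists_congr fun Y => and_congr_right fun hY => ?_
    have hF := fun p q => frob_symSingle p q hY.1
    rw [show (∀ c, frob ((E ∘ e) c) x + frob ((F ∘ e) c) Y = (g ∘ e) c) ↔
      ∀ c, frob (E c) x + frob (F c) Y = g c from e.forall_congr_left (p := fun c =>
        frob ((E ∘ e) c) x + frob ((F ∘ e) c) Y = (g ∘ e) c) |>.trans (by simp)]
    simp only [κ, Option.forall, Sum.forall, Prod.forall, E, F, g, hF, frob_single]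
    refine and_congr ?_ (and_congr (forall_congr' fun i => ?_)
      (forall_congr' fun i => forall_congr' fun j => ?_))
    · simp [frob]
    · constructor <;> intro h <;> linarith
    · constructor <;> intro h <;> linarith

lemma quadForm_nonneg {m : ℕ} {Y : Matrix (Fin m) (Fin m) ℝ} (hY : Y.PosSemidef)
    (w : Fin m → ℝ) : 0 ≤ ∑ i, ∑ j, w i * w j * Y i j := by
  have h := hY.dotProduct_mulVec_nonneg w
  simp only [dotProduct, Matrix.mulVec, Finset.mul_sum, Pi.star_apply, star_trivial] at h
  refine h.trans_eq (Finset.sum_congr rfl fun i _ => Finset.sum_congr rfl fun j _ => by ring)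

lemma binaryForm_nonneg {m : ℕ} {Y : Matrix (Fin m) (Fin m) ℝ} (hY : Y.PosSemidef)
    (p q : Fin m) (s t : ℝ) : 0 ≤ s ^ 2 * Y p p + 2 * s * t * Y p q + t ^ 2 * Y q q := by
  have h := quadForm_nonneg (hY.submatrix ![p, q]) ![s, t]
  have hsymm : Y q p = Y p q := by simpa using hY.1.apply p q
  simp [Fin.sum_univ_two, hsymm] at h
  linarith

/-- Only 2×2 principal submatrices are needed: those with the border index bound the diagonal, the
rest bound the other entries by diagonal averages. -/
lemma corSDP_abs_le_one {n : ℕ} {x : Matrix (Fin n) (Fin n) ℝ} (hx : x ∈ corSDP n)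
    (i j : Fin n) : |x i j| ≤ 1 := by
  obtain ⟨Y, hY, h0, hd, hx⟩ := hx
  have hdiag : ∀ i, x i i ≤ 1 := by
    intro i
    have h := binaryForm_nonneg hY 0 i.succ 1 (-1)
    rw [h0, hd, hx] at h
    linarith
  have h1 := binaryForm_nonneg hY i.succ j.succ 1 1
  have h2 := binaryForm_nonneg hY i.succ j.succ 1 (-1)
  rw [hx, hx, hx] at h1 h2
  have h3 := hdiag i
  have h4 := hdiag j
  rw [abs_le]
  constructor <;> linarith

lemma frob_outer {n : ℕ} (a : Fin n → ℝ) (x : Matrix (Fin n) (Fin n) ℝ) :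
    frob ((2 : ℝ) • Matrix.diagonal a - Matrix.vecMulVec a a) x =
      2 * ∑ i, a i * x i i - ∑ i, ∑ j, a i * a j * x i j := by
  unfold frob
  rw [Finset.mul_sum, ← Finset.sum_sub_distrib]
  refine Finset.sum_congr rfl fun i _ => ?_
  simp only [Matrix.sub_apply, Matrix.smul_apply, Matrix.vecMulVec_apply, smul_eq_mul, sub_mul,
    Finset.sum_sub_distrib]
  congr 1
  rw [Finset.sum_eq_single i]
  · simp [mul_assoc]
  · intro j _ hj
    simp [Matrix.diagonal_apply_ne _ hj.symm]
  · simp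

/-- The quadratic form of `Y` at `(1, -a)` is exactly the slack. -/
lemma corSDP_subset_outerQ (n : ℕ) : corSDP n ⊆ outerQ n := by
  rintro x ⟨Y, hY, h0, hd, hx⟩ a -
  have h := quadForm_nonneg hY (Fin.cons 1 (fun i => -a i))
  have hd' : ∀ i, Y (Fin.succ i) 0 = x i i := fun i => by
    rw [← hd]
    simpa using hY.1.apply 0 i.succ
  simp only [Fin.sum_univ_succ, Fin.cons_zero, Fin.cons_succ, h0, hd, hd', hx, neg_mul_neg,
    Finset.sum_add_distrib] at h
  rw [frob_outer]
  simp only [one_mul, mul_one, neg_mul, Finset.sum_neg_distrib] at h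
  linarith

lemma corSDP_convex (n : ℕ) : Convex ℝ (corSDP n) := by
  rintro x ⟨Y, hY, h0, hd, hx⟩ x' ⟨Y', hY', h0', hd', hx'⟩ s t hs ht hst
  refine ⟨s • Y + t • Y', (hY.smul hs).add (hY'.smul ht), ?_, fun i => ?_, fun i j => ?_⟩
  · simp [h0, h0', hst]
  · simp [hd, hd']
  · simp [hx, hx']

lemma vecMulVec_mem_corSDP {n : ℕ} {b : Fin n → ℝ} (hb : IsBinary b) :
    Matrix.vecMulVec b b ∈ corSDP n := by
  refine ⟨Matrix.vecMulVec (Fin.cons 1 b) (Fin.cons 1 b), ?_, ?_, fun i => ?_, fun i j => ?_⟩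
  · simpa using Matrix.posSemidef_vecMulVec_self_star (Fin.cons 1 b : Fin (n + 1) → ℝ)
  · simp [Matrix.vecMulVec_apply]
  -- The border equals the diagonal because `b i ^ 2 = b i`.
  · rcases hb i with h | h <;> simp [Matrix.vecMulVec_apply, h]
  · simp [Matrix.vecMulVec_apply]

lemma COR_subset_corSDP (n : ℕ) : COR n ⊆ corSDP n :=
  convexHull_min (by rintro _ ⟨b, hb, rfl⟩; exact vecMulVec_mem_corSDP hb) (corSDP_convex n)

/-! ### The lower bound -/

/-- The constraint matrix has entries in `[-1, 1]`, so moving by `ε` in `ℓ₁` changes its value by at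
most `ε`. -/
lemma frob_outer_le_of_mem_l1Neighbourhood {n : ℕ} {ε : ℝ} {x : Matrix (Fin n) (Fin n) ℝ}
    (hx : x ∈ l1Neighbourhood (corSDP n) ε) {a : Fin n → ℝ} (ha : IsBinary a) :
    frob ((2 : ℝ) • Matrix.diagonal a - Matrix.vecMulVec a a) x ≤ 1 + ε := by
  obtain ⟨x₀, hx₀, hd⟩ := hx
  have h1 := corSDP_subset_outerQ n hx₀ a ha
  have h2 := frob_le_l1Norm (A := (2 : ℝ) • Matrix.diagonal a - Matrix.vecMulVec a a)
    (fun i j => ?_) (x - x₀)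
  · have h3 := frob_add_right ((2 : ℝ) • Matrix.diagonal a - Matrix.vecMulVec a a) x₀ (x - x₀)
    rw [add_sub_cancel] at h3
    linarith
  · simp only [Matrix.sub_apply, Matrix.smul_apply, Matrix.vecMulVec_apply, smul_eq_mul]
    by_cases hij : i = j
    · subst hij
      rcases ha i with h | h <;> norm_num [h]
    · rcases ha i with h | h <;> rcases ha j with h' | h' <;> simp [h, h', hij]

lemma frob_outer_vecMulVec {n : ℕ} (a : Fin n → ℝ) {b : Fin n → ℝ} (hb : IsBinary b) :
    frob ((2 : ℝ) • Matrix.diagonal a - Matrix.vecMulVec a a) (Matrix.vecMulVec b b) =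
      2 * ∑ i, a i * b i - (∑ i, a i * b i) ^ 2 := by
  rw [frob_outer, sq, Finset.sum_mul_sum]
  congr 1
  · refine congrArg _ (Finset.sum_congr rfl fun i _ => ?_)
    rcases hb i with h | h <;> simp [Matrix.vecMulVec_apply, h]
  · refine Finset.sum_congr rfl fun i _ => Finset.sum_congr rfl fun j _ => ?_
    rw [Matrix.vecMulVec_apply]
    ring

/-- The real `0/1` vector of a Boolean vector. -/
def boolVec {n : ℕ} (a : Fin n → Bool) (i : Fin n) : ℝ := if a i then 1 else 0

lemma boolVec_isBinary {n : ℕ} (a : Fin n → Bool) : IsBinary (boolVec a) := fun i => by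
  unfold boolVec
  split <;> simp

lemma boolVec_mul_boolVec {n : ℕ} (a b : Fin n → Bool) (i : Fin n) :
    boolVec a i * boolVec b i = if (a i && b i) then 1 else 0 := by
  unfold boolVec
  cases a i <;> cases b i <;> simp

theorem log_size_ge {n r : ℕ} {ρ : ℝ} (hρ : 1 ≤ ρ) {K : Set (Matrix (Fin n) (Fin n) ℝ)}
    (hEF : HasEF K r) (hsub : corSDP n ⊆ K) (hsup : K ⊆ l1Neighbourhood (corSDP n) (ρ - 1)) :
    n / (16 * ρ) ≤ Real.log (r + 1) := by
  have hρ0 : 0 < ρ := by linarith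
  have hbK : ∀ b : Fin n → Bool, Matrix.vecMulVec (boolVec b) (boolVec b) ∈ K := fun b =>
    hsub (vecMulVec_mem_corSDP (boolVec_isBinary b))
  obtain ⟨y, hy, hfac⟩ := hEF.exists_slack_factorization ⟨_, hbK fun _ => false⟩
  have hval := fun a : Fin n → Bool => hfac
    ((2 : ℝ) • Matrix.diagonal (boolVec a) - Matrix.vecMulVec (boolVec a) (boolVec a)) ρ
    (fun x hx => (frob_outer_le_of_mem_l1Neighbourhood (hsup hx) (boolVec_isBinary a)).trans_eq
      (by ring))
  choose l hl hlx using hval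
  -- Dividing by `ρ` normalizes disjoint pairs to `1`, so one intersection gives `1 - δ` with `δ = 1
  -- / ρ`.
  have hslack : ∀ a b : Fin n → Bool,
      ∑ k, l a k / ρ * y (Matrix.vecMulVec (boolVec b) (boolVec b)) k =
        (ρ - 2 * ∑ i, boolVec a i * boolVec b i + (∑ i, boolVec a i * boolVec b i) ^ 2) / ρ := by
    intro a b
    have h := hlx a _ (hbK b)
    rw [frob_outer_vecMulVec _ (boolVec_isBinary b)] at h
    rw [← sub_add] at h
    rw [h, Finset.sum_div]
    exact Finset.sum_congr rfl fun k _ => by ring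
  have h := log_card_ge_of_factorization (ι := Fin n) (κ := Fin (r + 1))
    (fun k a => l a k / ρ) (fun k b => y (Matrix.vecMulVec (boolVec b) (boolVec b)) k)
    (fun k a => div_nonneg (hl a k) hρ0.le) (fun k b => hy _ (hbK b) k)
    (δ := 1 / ρ) ((div_le_one hρ0).mpr hρ)
    (fun a b hab => by
      rw [hslack, Finset.sum_eq_zero (s := Finset.univ) (f := fun i => boolVec a i * boolVec b i)
        fun i _ => by
          rw [boolVec_mul_boolVec, hab i]; simp]
      field_simp
      ring)
    (fun a b i ha hb hab => by
      rw [hslack, Finset.sum_eq_single (f := fun i => boolVec a i * boolVec b i) i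
        (fun j _ hj => by rw [boolVec_mul_boolVec, hab j hj]; simp) (by simp),
        boolVec_mul_boolVec, ha, hb]
      field_simp
      simp
      ring)
  simp only [Fintype.card_fin, Nat.cast_add, Nat.cast_one] at h
  refine le_of_eq_of_le ?_ h
  field_simp

/-- The exponent `1 - β` would already be available; the extra factor `n ^ (-β)` is at most `C`
because `1 ≤ ρ ≤ C * n ^ β`, also for negative `β`. -/
lemma rpow_one_sub_two_mul_le {β C ρ : ℝ} {n : ℕ} (hn : 1 ≤ n) (hC : 1 ≤ C) (hρ : 1 ≤ ρ)
    (hρC : ρ ≤ C * (n : ℝ) ^ β) :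
    1 / (16 * C ^ 2) * (n : ℝ) ^ (1 - 2 * β) ≤ n / (16 * ρ) := by
  have hn1 : (1 : ℝ) ≤ n := by exact_mod_cast hn
  have hn0 : (0 : ℝ) < n := by linarith
  have hnβ : 0 < (n : ℝ) ^ β := Real.rpow_pos_of_pos hn0 _
  have hneg : ((n : ℝ) ^ β)⁻¹ ≤ C := by
    rw [inv_le_comm₀ hnβ (by linarith)]
    rw [inv_le_iff_one_le_mul₀ (by linarith)]
    linarith
  have hsplit : (n : ℝ) ^ (1 - 2 * β) = n * ((n : ℝ) ^ β)⁻¹ * ((n : ℝ) ^ β)⁻¹ := by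
    rw [← Real.rpow_neg hn0.le, mul_assoc, ← Real.rpow_add hn0, Real.rpow_sub hn0, Real.rpow_one,
      div_eq_mul_inv, ← Real.rpow_neg hn0.le]
    ring_nf
  have hmain : (n : ℝ) / (16 * (C * (n : ℝ) ^ β)) ≤ n / (16 * ρ) := by gcongr
  refine le_trans ?_ hmain
  rw [hsplit]
  have e : (n : ℝ) / (16 * (C * (n : ℝ) ^ β)) =
      1 / (16 * C ^ 2) * (n * ((n : ℝ) ^ β)⁻¹ * C) := by
    field_simp
  rw [e]
  gcongr

theorem corSDP_inapprox {β : ℝ} (hβ : β < 1 / 2) (C : ℝ) :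
    ∃ c : ℝ, 0 < c ∧ ∃ N : ℕ, ∀ n : ℕ, N ≤ n → ∀ ρ : ℝ, 1 ≤ ρ → ρ ≤ C * (n : ℝ) ^ β →
      ∀ K : Set (Matrix (Fin n) (Fin n) ℝ), IsPolyhedron K →
        corSDP n ⊆ K → K ⊆ l1Neighbourhood (corSDP n) (ρ - 1) →
        (2 : ℝ) ^ (c * (n : ℝ) ^ (1 - 2 * β)) ≤ (xc K : ℝ) := by
  set C' := max C 1 with hC'
  have hC1 : 1 ≤ C' := le_max_right _ _
  set d : ℝ := 1 / (16 * C' ^ 2) with hd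
  have hd0 : 0 < d := by positivity
  have hev := (((tendsto_rpow_atTop (show 0 < 1 - 2 * β by linarith)).comp
    tendsto_natCast_atTop_atTop).const_mul_atTop hd0).eventually_ge_atTop 2
  obtain ⟨N, hN⟩ := Filter.eventually_atTop.mp hev
  refine ⟨d / 2, by positivity, max N 1, fun n hn ρ hρ hρC K hK hsub hsup => ?_⟩
  have hz := hN n (le_of_max_le_left hn)
  simp only [Function.comp_apply] at hz
  have hρC' : ρ ≤ C' * (n : ℝ) ^ β :=
    hρC.trans (mul_le_mul_of_nonneg_right (le_max_left _ _) (by positivity))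
  have h1 := rpow_one_sub_two_mul_le (le_of_max_le_right hn) hC1 hρ hρC'
  have h2 := h1.trans (log_size_ge hρ hK.hasEF_xc hsub hsup)
  rw [← hd] at h2
  set z := d * (n : ℝ) ^ (1 - 2 * β) with hzdef
  have h3 : Real.exp z ≤ xc K + 1 := (Real.le_log_iff_exp_le (by positivity)).mp h2
  -- Halving the exponent absorbs the `+ 1`: for `z ≥ 2`, `e = exp (z / 2)` is at least `2`, so `e ^
  -- 2 - 1 ≥ e`.
  have h4 : Real.exp z = Real.exp (z / 2) * Real.exp (z / 2) := by
    rw [← Real.exp_add]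
    ring_nf
  have h5 := Real.add_one_le_exp (z / 2)
  have h6 : (2 : ℝ) ^ (z / 2) ≤ Real.exp (z / 2) := by
    rw [← Real.exp_one_rpow (z / 2)]
    refine Real.rpow_le_rpow zero_le_two ?_ (by linarith)
    linarith [Real.add_one_le_exp 1]
  have h7 : d / 2 * (n : ℝ) ^ (1 - 2 * β) = z / 2 := by ring
  rw [h7]
  nlinarith

end SDPInapprox

theorem theorem6 :
    ∃ S : (n : ℕ) → Set (Matrix (Fin n) (Fin n) ℝ),
      -- `S n` is a spectrahedron of semidefinite extension complexity at most `n + 1`,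
      -- with `COR(n) ⊆ S n ⊆ Q(n)` and `S n ⊆ [-1,1]^{n×n}`
      (∀ n : ℕ, 0 < n →
        SDPInapprox.IsSpectrahedron (S n) ∧ SDPInapprox.xcSDP (S n) ≤ n + 1 ∧
        SDPInapprox.COR n ⊆ S n ∧ S n ⊆ SDPInapprox.outerQ n ∧
        ∀ x ∈ S n, ∀ i j, |x i j| ≤ 1) ∧
      -- constant `ρ`: `xc(K) = 2^{Ω(n)}`
      (∀ ρ : ℝ, 1 ≤ ρ →
        ∃ c : ℝ, 0 < c ∧ ∃ N : ℕ, ∀ n : ℕ, N ≤ n →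
          ∀ K : Set (Matrix (Fin n) (Fin n) ℝ), SDPInapprox.IsPolyhedron K →
            S n ⊆ K → K ⊆ SDPInapprox.l1Neighbourhood (S n) (ρ - 1) →
            (2 : ℝ) ^ (c * (n : ℝ)) ≤ (SDPInapprox.xc K : ℝ)) ∧
      -- `ρ = O(n^β)` with `β < 1/2`: `xc(K) = 2^{Ω(n^{1-2β})}`
      (∀ β : ℝ, β < 1 / 2 → ∀ C : ℝ,
        ∃ c : ℝ, 0 < c ∧ ∃ N : ℕ, ∀ n : ℕ, N ≤ n →
          ∀ ρ : ℝ, 1 ≤ ρ → ρ ≤ C * (n : ℝ) ^ β →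
          ∀ K : Set (Matrix (Fin n) (Fin n) ℝ), SDPInapprox.IsPolyhedron K →
            S n ⊆ K → K ⊆ SDPInapprox.l1Neighbourhood (S n) (ρ - 1) →
            (2 : ℝ) ^ (c * (n : ℝ) ^ (1 - 2 * β)) ≤ (SDPInapprox.xc K : ℝ)) := by
  refine ⟨SDPInapprox.corSDP, fun n _ => ⟨⟨_, SDPInapprox.corSDP_hasSemidefiniteEF n⟩,
    Nat.sInf_le (SDPInapprox.corSDP_hasSemidefiniteEF n), SDPInapprox.COR_subset_corSDP n,
    SDPInapprox.corSDP_subset_outerQ n, fun x hx => SDPInapprox.corSDP_abs_le_one hx⟩,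
    fun ρ hρ => ?_, fun β hβ C => SDPInapprox.corSDP_inapprox hβ C⟩
  -- Constant `ρ` is the case `β = 0`, `C = ρ`.
  obtain ⟨c, hc, N, h⟩ := SDPInapprox.corSDP_inapprox (β := 0) (by norm_num) ρ
  refine ⟨c, hc, N, fun n hn K hK hsub hsup => ?_⟩
  simpa using h n hn ρ hρ (by simp) K hK hsub hsup
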